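/- Let $c_{00}$ be the space of finitely supported real sequences indexed by $\mathbb N$, with unit vector basis $(e_k)$, and for a finite set $E\subset\mathbb N$ let $Ex$ be the restriction of $x\in c_{00}$ to $E$. A family of finite subsets of $\mathbb N$ is *regular* if it is hereditary, spreading (if $\{n_1<\dots<n_k\}$ belongs to it, $m_1<\dots<m_k$ and $m_i\ge n_i$ for all $i$, then $\{m_1,\dots,m_k\}$ belongs to it) and compact in $2^{\mathbb N}$. For finite sets, $E<F$ means $\max E<\min F$. A finite sequence of nonempty finite sets $E_1<\dots<E_k$ is $\mathcal M$-*admissible* if $\{\min E_1,\dots,\min E_k\}\in\mathcal M$. Put $$\mathcal M[\mathcal N]=\Big\{\bigcup_{i=1}^kE_i:\ E_1,\dots,E_k\in\mathcal N,\ (E_i)_{i=1}^k\ \mathcal M\text{-admissible}\Big\},$$ $[\mathcal M]=\mathcal M$ and $[\mathcal M_1,\dots,\mathcal M_{i+1}]=[\mathcal M_1,\dots,\mathcal M_i]\,[\mathcal M_{i+1}]$. Put $\|x\|_{\mathcal B}=\sup_{F\in\mathcal B}\sum_{k\in F}|x_k|$. Let $(\mathcal F_n)_{n\ge0}$ be regular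 families, each containing all singletons, such that $\mathcal F=\bigcup_{n\ge0}\mathcal F_n$ is regular, and let $(\theta_n)_{n\ge1}$ be a nonincreasing null sequence in $(0,1)$. For a family $\mathcal B$, the norm of the mixed Tsirelson space $T(\mathcal B,(\theta_n,\mathcal F_n)_{n\ge1})$ is determined on $c_{00}$ by $$\|x\|=\max\Big\{\|x\|_{\mathcal B},\ \sup_{n\ge1}\ \sup\Big\{\theta_n\sum_{i=1}^k\|E_ix\|:\ (E_i)_{i=1}^k\ \mathcal F_n\text{-admissible}\Big\}\Big\}.$$ Let $\|\cdot\|$ be the norm of $X=T(\mathcal F_0,(\theta_n,\mathcal F_n)_{n\ge1})$. **Proposition.** For every $\varepsilon>0$ and every integer $m_0\ge1$ there is a constant $K=K(\varepsilon,m_0)<\infty$ with the following property. Let $\mathcal G$ be a regular family such that for every $m\ge m_0$ there are $s\ge1$ and $n_1,\dots,n_s\ge1$ with $$\theta_m<\varepsilon\,\theta_{n_1}\cdots\theta_{n_s}\quad\text{and}\quad \mathcal F_m\subseteq[\mathcal G,\mathcal F_{n_1},\dots,\mathcal F_{n_s}].$$ Then for every finite block sequence $(x_k)_{k=1}^p$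 of $(e_k)$ (nonzero $x_k\in c_{00}$ with $\operatorname{supp}x_1<\dots<\operatorname{supp}x_p$) that is normalized in $X$, and all real $a_1,\dots,a_p$, $$\Big\|\sum_{k=1}^pa_kx_k\Big\|\le K\Big\|\sum_{k=1}^pa_ke_{i_k}\Big\|+2\varepsilon\,\rho_1\Big(\sum_{k=1}^pa_ke_{i_k}\Big)+2\rho_2\Big(\sum_{k=1}^pa_ke_{i_k}\Big)+2\varepsilon\sum_{k=1}^p|a_k|,$$ where $i_k=\max\operatorname{supp}x_k$, and $\rho_1$, $\rho_2$ are the norms of $T(\mathcal F,(\theta_n,\mathcal F_n)_{n\ge1})$ and $T(\mathcal G,(\theta_n,\mathcal F_n)_{n\ge1})$, respectively. -/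

import Mathlib

open Filter Topology

namespace MixedTsirelson

/-- Every subset of a member is a member. -/
def Hereditary (𝓕 : Set (Finset ℕ)) : Prop :=
  ∀ F ∈ 𝓕, ∀ G : Finset ℕ, G ⊆ F → G ∈ 𝓕

/-- If `{n₁ < ⋯ < nₖ}` is a member, `m₁ < ⋯ < mₖ` and `mᵢ ≥ nᵢ`, then `{m₁, …, mₖ}` is a member;
here `mᵢ = φ nᵢ`. -/
def Spreading (𝓕 : Set (Finset ℕ)) : Prop :=
  ∀ F ∈ 𝓕, ∀ φ : ℕ → ℕ, StrictMonoOn φ (F : Set ℕ) → (∀ n ∈ F, n ≤ φ n) → F.image φ ∈ 𝓕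

/-- The indicator of a finite set, as a point of the product space `2^ℕ`. -/
def indicator (F : Finset ℕ) : ℕ → Bool := fun n => decide (n ∈ F)

/-- A regular family of finite sets: hereditary, spreading, and compact in `2^ℕ`. -/
structure IsRegular (𝓕 : Set (Finset ℕ)) : Prop where
  hereditary : Hereditary 𝓕
  spreading : Spreading 𝓕
  compact : IsCompact (indicator '' 𝓕)

/-- `E₁, …, Eₖ` are (nonempty) finite sets with `E₁ < ⋯ < Eₖ` and
`{min E₁, …, min Eₖ} ∈ 𝓜`. -/
def Admissible (𝓜 : Set (Finset ℕ)) {k : ℕ} (E : Fin k → Finset ℕ) : Prop :=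
  (∀ i j, i < j → ∀ a ∈ E i, ∀ b ∈ E j, a < b) ∧
    ∃ m : Fin k → ℕ, (∀ i, IsLeast (E i : Set ℕ) (m i)) ∧ Finset.univ.image m ∈ 𝓜

/-- `𝓜[𝓗]`: the unions of `𝓜`-admissible sequences of members of `𝓗`. -/
def conv (𝓜 𝓗 : Set (Finset ℕ)) : Set (Finset ℕ) :=
  {A | ∃ (k : ℕ) (E : Fin k → Finset ℕ),
    (∀ i, E i ∈ 𝓗) ∧ Admissible 𝓜 E ∧ A = Finset.univ.biUnion E}

/-- `[𝓜, 𝓗₁, …, 𝓗ₛ] = (⋯((𝓜[𝓗₁])[𝓗₂])⋯)[𝓗ₛ]`. -/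
def bracket (𝓜 : Set (Finset ℕ)) (L : List (Set (Finset ℕ))) : Set (Finset ℕ) :=
  L.foldl conv 𝓜

/-- The coordinate projection `E x` of `x ∈ c₀₀`. -/
noncomputable def proj (E : Finset ℕ) (x : ℕ →₀ ℝ) : ℕ →₀ ℝ := x.filter (· ∈ E)

/-- `‖x‖_𝓕 = sup_{F ∈ 𝓕} ∑_{k ∈ F} |x k|`. -/
noncomputable def familyNorm (𝓕 : Set (Finset ℕ)) (x : ℕ →₀ ℝ) : ℝ :=
  sSup {r | ∃ F ∈ 𝓕, r = ∑ k ∈ F, |x k|}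

/-- The numbers `θₙ ∑ᵢ ν (Eᵢ x)`, where `n ≥ 1` and `(Eᵢ)` is `𝓕ₙ`-admissible. -/
def admissibleSums (θ : ℕ → ℝ) (𝓕 : ℕ → Set (Finset ℕ)) (ν : (ℕ →₀ ℝ) → ℝ) (x : ℕ →₀ ℝ) :
    Set ℝ :=
  {r | ∃ n, 1 ≤ n ∧ ∃ (k : ℕ) (E : Fin k → Finset ℕ),
    Admissible (𝓕 n) E ∧ r = θ n * ∑ i, ν (proj (E i) x)}

/-- The right-hand side of the implicit equation, as an operator on functions on `c₀₀`. -/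
noncomputable def step (𝓑 : Set (Finset ℕ)) (θ : ℕ → ℝ) (𝓕 : ℕ → Set (Finset ℕ))
    (ν : (ℕ →₀ ℝ) → ℝ) (x : ℕ →₀ ℝ) : ℝ :=
  max (familyNorm 𝓑 x) (sSup (admissibleSums θ 𝓕 ν x))

/-- The norm, on `c₀₀`, of the mixed Tsirelson space `T(𝓑, (θₙ, 𝓕ₙ)_{n ≥ 1})`: the supremum of
the iterates of `step` that start from `‖·‖_𝓑`. It solves the implicit equation
(`tsirelsonNorm_eq`) and is its only solution (`tsirelsonNorm_unique`). The values of `θ` and `𝓕`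
at index `0` play no role. -/
noncomputable def tsirelsonNorm (𝓑 : Set (Finset ℕ)) (θ : ℕ → ℝ) (𝓕 : ℕ → Set (Finset ℕ))
    (x : ℕ →₀ ℝ) : ℝ :=
  ⨆ j : ℕ, (step 𝓑 θ 𝓕)^[j] (familyNorm 𝓑) x

/-- `(x₁, …, xₚ)` is a block sequence of the unit vector basis: nonzero finitely supported vectors
with `supp x₁ < ⋯ < supp xₚ`. -/
def IsBlockSequence {p : ℕ} (x : Fin p → ℕ →₀ ℝ) : Prop :=
  (∀ k, x k ≠ 0) ∧
    ∀ k l, k < l → ∀ a ∈ (x k).support, ∀ b ∈ (x l).support, a < b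

section ImplicitEquation

/-- The `ℓ¹` norm, used only to see that the suprema above are finite. -/
noncomputable def l1 (x : ℕ →₀ ℝ) : ℝ := ∑ k ∈ x.support, |x k|

theorem sum_le_l1 (F : Finset ℕ) (x : ℕ →₀ ℝ) : ∑ k ∈ F, |x k| ≤ l1 x := by
  classical
  have h : ∑ k ∈ F, |x k| = ∑ k ∈ F ∩ x.support, |x k| := by
    refine (Finset.sum_subset Finset.inter_subset_left ?_).symm
    intro k hk hk'
    have : x k = 0 := by
      by_contra h0
      exact hk' (Finset.mem_inter.2 ⟨hk, Finsupp.mem_support_iff.2 h0⟩)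
    simp [this]
  rw [h]
  exact Finset.sum_le_sum_of_subset_of_nonneg Finset.inter_subset_right
    fun _ _ _ => abs_nonneg _

theorem l1_nonneg (x : ℕ →₀ ℝ) : 0 ≤ l1 x := Finset.sum_nonneg fun _ _ => abs_nonneg _

theorem familyNorm_bdd (𝓕 : Set (Finset ℕ)) (x : ℕ →₀ ℝ) :
    BddAbove {r | ∃ F ∈ 𝓕, r = ∑ k ∈ F, |x k|} :=
  ⟨l1 x, by rintro _ ⟨F, -, rfl⟩; exact sum_le_l1 F x⟩

theorem familyNorm_le (𝓕 : Set (Finset ℕ)) (x : ℕ →₀ ℝ) : familyNorm 𝓕 x ≤ l1 x :=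
  Real.sSup_le (by rintro _ ⟨F, -, rfl⟩; exact sum_le_l1 F x) (l1_nonneg x)

theorem familyNorm_nonneg (𝓕 : Set (Finset ℕ)) (x : ℕ →₀ ℝ) : 0 ≤ familyNorm 𝓕 x :=
  Real.sSup_nonneg (by rintro _ ⟨F, -, rfl⟩; exact Finset.sum_nonneg fun _ _ => abs_nonneg _)

theorem l1_proj (E : Finset ℕ) (x : ℕ →₀ ℝ) : l1 (proj E x) = ∑ k ∈ E ∩ x.support, |x k| := by
  classical
  have hs : (proj E x).support = E ∩ x.support := by
    ext k; simp [proj, Finsupp.support_filter, and_comm]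
  unfold l1
  rw [hs]
  refine Finset.sum_congr rfl fun k hk => ?_
  rw [proj, Finsupp.filter_apply_pos _ _ (Finset.mem_inter.1 hk).1]

theorem sum_l1_proj_le {𝓜 : Set (Finset ℕ)} {k : ℕ} {E : Fin k → Finset ℕ}
    (hE : Admissible 𝓜 E) (x : ℕ →₀ ℝ) : ∑ i, l1 (proj (E i) x) ≤ l1 x := by
  classical
  simp only [l1_proj]
  rw [← Finset.sum_biUnion]
  · refine Finset.sum_le_sum_of_subset_of_nonneg ?_ fun _ _ _ => abs_nonneg _
    intro a ha
    obtain ⟨i, -, h⟩ := Finset.mem_biUnion.1 ha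
    exact (Finset.mem_inter.1 h).2
  · intro i _ j _ hij
    refine Finset.disjoint_left.2 fun a ha hb => ?_
    have ha := (Finset.mem_inter.1 ha).1
    have hb := (Finset.mem_inter.1 hb).1
    rcases lt_or_gt_of_ne hij with h | h
    · exact lt_irrefl _ (hE.1 _ _ h a ha a hb)
    · exact lt_irrefl _ (hE.1 _ _ h a hb a ha)

variable {𝓑 : Set (Finset ℕ)} {θ : ℕ → ℝ} {𝓕 : ℕ → Set (Finset ℕ)}

theorem admissibleSums_le (hθ : ∀ n, 1 ≤ n → 0 < θ n ∧ θ n < 1) {ν : (ℕ →₀ ℝ) → ℝ}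
    (hν : ∀ x, ν x ≤ l1 x) (x : ℕ →₀ ℝ) : ∀ r ∈ admissibleSums θ 𝓕 ν x, r ≤ l1 x := by
  rintro _ ⟨n, hn, k, E, hE, rfl⟩
  have h1 : ∑ i, ν (proj (E i) x) ≤ l1 x :=
    (Finset.sum_le_sum fun i _ => hν _).trans (sum_l1_proj_le hE x)
  have h2 := hθ n hn
  nlinarith [l1_nonneg x, mul_le_mul_of_nonneg_left h1 h2.1.le]

theorem iterate_le (hθ : ∀ n, 1 ≤ n → 0 < θ n ∧ θ n < 1) (j : ℕ) :
    ∀ x, (step 𝓑 θ 𝓕)^[j] (familyNorm 𝓑) x ≤ l1 x := by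
  induction j with
  | zero => exact familyNorm_le 𝓑
  | succ j ih =>
    intro x
    rw [Function.iterate_succ_apply']
    exact max_le (familyNorm_le 𝓑 x)
      (Real.sSup_le (admissibleSums_le hθ ih x) (l1_nonneg x))

theorem step_mono (hθ : ∀ n, 1 ≤ n → 0 < θ n ∧ θ n < 1) {ν μ : (ℕ →₀ ℝ) → ℝ}
    (hμ : ∀ x, BddAbove (admissibleSums θ 𝓕 μ x)) (h0 : ∀ x, 0 ≤ μ x)
    (h : ∀ x, ν x ≤ μ x) (x : ℕ →₀ ℝ) : step 𝓑 θ 𝓕 ν x ≤ step 𝓑 θ 𝓕 μ x := by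
  refine max_le_max le_rfl (Real.sSup_le ?_ (Real.sSup_nonneg ?_))
  · rintro _ ⟨n, hn, k, E, hE, rfl⟩
    exact (mul_le_mul_of_nonneg_left (Finset.sum_le_sum fun i _ => h _) (hθ n hn).1.le).trans
      (le_csSup (hμ x) ⟨n, hn, k, E, hE, rfl⟩)
  · rintro _ ⟨n, hn, k, E, hE, rfl⟩
    exact mul_nonneg (hθ n hn).1.le (Finset.sum_nonneg fun i _ => h0 _)

theorem iterate_nonneg (j : ℕ) : ∀ x, 0 ≤ (step 𝓑 θ 𝓕)^[j] (familyNorm 𝓑) x := by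
  intro x
  cases j with
  | zero => exact familyNorm_nonneg 𝓑 x
  | succ j =>
    rw [Function.iterate_succ_apply']
    exact (familyNorm_nonneg 𝓑 x).trans (le_max_left _ _)

theorem iterate_mono (hθ : ∀ n, 1 ≤ n → 0 < θ n ∧ θ n < 1) (x : ℕ →₀ ℝ) :
    Monotone fun j => (step 𝓑 θ 𝓕)^[j] (familyNorm 𝓑) x := by
  refine monotone_nat_of_le_succ fun j => ?_
  induction j generalizing x with
  | zero => exact le_max_left _ _
  | succ j ih =>
    rw [Function.iterate_succ_apply', Function.iterate_succ_apply' _ (j + 1)]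
    exact step_mono hθ (fun y => ⟨l1 y, admissibleSums_le hθ (iterate_le hθ (j + 1)) y⟩)
      (iterate_nonneg (j + 1)) ih x

theorem iterate_bdd (hθ : ∀ n, 1 ≤ n → 0 < θ n ∧ θ n < 1) (x : ℕ →₀ ℝ) :
    BddAbove (Set.range fun j : ℕ => (step 𝓑 θ 𝓕)^[j] (familyNorm 𝓑) x) :=
  ⟨l1 x, by rintro _ ⟨j, rfl⟩; exact iterate_le hθ j x⟩

theorem tsirelsonNorm_le (hθ : ∀ n, 1 ≤ n → 0 < θ n ∧ θ n < 1) (x : ℕ →₀ ℝ) :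
    tsirelsonNorm 𝓑 θ 𝓕 x ≤ l1 x :=
  ciSup_le fun j => iterate_le hθ j x

theorem tsirelsonNorm_nonneg (x : ℕ →₀ ℝ) : 0 ≤ tsirelsonNorm 𝓑 θ 𝓕 x :=
  Real.iSup_nonneg fun j => iterate_nonneg j x

theorem admissibleSums_bdd (hθ : ∀ n, 1 ≤ n → 0 < θ n ∧ θ n < 1) (x : ℕ →₀ ℝ) :
    BddAbove (admissibleSums θ 𝓕 (tsirelsonNorm 𝓑 θ 𝓕) x) :=
  ⟨l1 x, admissibleSums_le hθ (tsirelsonNorm_le hθ) x⟩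

/-- The implicit equation
`‖x‖ = max {‖x‖_𝓑, sup_n sup θₙ ∑ᵢ ‖Eᵢ x‖}` holds (with finite suprema). -/
theorem tsirelsonNorm_eq (hθ : ∀ n, 1 ≤ n → 0 < θ n ∧ θ n < 1) (x : ℕ →₀ ℝ) :
    tsirelsonNorm 𝓑 θ 𝓕 x = max (familyNorm 𝓑 x)
      (sSup (admissibleSums θ 𝓕 (tsirelsonNorm 𝓑 θ 𝓕) x)) := by
  have hlim : ∀ y, Tendsto (fun j => (step 𝓑 θ 𝓕)^[j] (familyNorm 𝓑) y) atTop
      (𝓝 (tsirelsonNorm 𝓑 θ 𝓕 y)) := fun y =>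
    tendsto_atTop_ciSup (iterate_mono hθ y) (iterate_bdd hθ y)
  have hle : ∀ j y, (step 𝓑 θ 𝓕)^[j] (familyNorm 𝓑) y ≤ tsirelsonNorm 𝓑 θ 𝓕 y := fun j y =>
    le_ciSup (iterate_bdd hθ y) j
  apply le_antisymm
  · refine ciSup_le fun j => ?_
    cases j with
    | zero => exact le_max_left _ _
    | succ j =>
      rw [Function.iterate_succ_apply']
      exact step_mono hθ (admissibleSums_bdd hθ) tsirelsonNorm_nonneg (hle j) x
  · refine max_le (hle 0 x) (Real.sSup_le ?_ (tsirelsonNorm_nonneg x))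
    rintro _ ⟨n, hn, k, E, hE, rfl⟩
    refine le_of_tendsto ((tendsto_finsetSum _ fun i _ => hlim (proj (E i) x)).const_mul (θ n))
      (Eventually.of_forall fun j => ?_)
    refine le_trans ?_ (hle (j + 1) x)
    rw [Function.iterate_succ_apply']
    exact le_trans (le_csSup ⟨l1 x, admissibleSums_le hθ (iterate_le hθ j) x⟩
      ⟨n, hn, k, E, hE, rfl⟩) (le_max_right _ _)

/-- A nonnegative function vanishing at `0` (in particular a norm) that satisfies the implicit
equation, with finite suprema, is `tsirelsonNorm`. -/
theorem tsirelsonNorm_unique (hθ : ∀ n, 1 ≤ n → 0 < θ n ∧ θ n < 1)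
    (hθ_anti : ∀ m n, 1 ≤ m → m ≤ n → θ n ≤ θ m) {ν : (ℕ →₀ ℝ) → ℝ}
    (h0 : ∀ x, 0 ≤ ν x) (hz : ν 0 = 0) (hb : ∀ x, BddAbove (admissibleSums θ 𝓕 ν x))
    (heq : ∀ x, ν x = max (familyNorm 𝓑 x) (sSup (admissibleSums θ 𝓕 ν x))) :
    ν = tsirelsonNorm 𝓑 θ 𝓕 := by
  classical
  funext x
  apply le_antisymm
  · induction hN : x.support.card using Nat.strong_induction_on generalizing x with
    | _ N ih =>
    by_cases hx : x = 0
    · rw [hx, hz]; exact tsirelsonNorm_nonneg 0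
    have key : ν x ≤ max (tsirelsonNorm 𝓑 θ 𝓕 x) (θ 1 * ν x) := by
      conv_lhs => rw [heq x]
      refine max_le (le_max_of_le_left ?_) (Real.sSup_le ?_ ?_)
      · rw [tsirelsonNorm_eq hθ]; exact le_max_left _ _
      · rintro _ ⟨n, hn, k, E, hE, rfl⟩
        by_cases hi : ∃ i, x.support ⊆ E i
        · obtain ⟨i, hi⟩ := hi
          refine le_max_of_le_right ?_
          have hpi : proj (E i) x = x :=
            (Finsupp.filter_eq_self_iff _ _).2 fun a ha => hi (Finsupp.mem_support_iff.2 ha)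
          rw [Finset.sum_eq_single i, hpi]
          · exact mul_le_mul_of_nonneg_right (hθ_anti 1 n le_rfl hn) (h0 x)
          · intro j _ hj
            have : proj (E j) x = 0 := by
              refine (Finsupp.filter_eq_zero_iff _ _).2 fun a ha => ?_
              by_contra hxa
              have hb := hi (Finsupp.mem_support_iff.2 hxa)
              rcases lt_or_gt_of_ne hj with h | h
              · exact lt_irrefl _ (hE.1 _ _ h a ha a hb)
              · exact lt_irrefl _ (hE.1 _ _ h a hb a ha)
            rw [this, hz]
          · simp
        · push Not at hi
          refine le_max_of_le_left ?_
          rw [tsirelsonNorm_eq hθ]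
          refine le_max_of_le_right (le_trans ?_
            (le_csSup (admissibleSums_bdd hθ x) ⟨n, hn, k, E, hE, rfl⟩))
          refine mul_le_mul_of_nonneg_left (Finset.sum_le_sum fun i _ => ?_) (hθ n hn).1.le
          refine ih _ ?_ _ rfl
          rw [← hN]
          refine Finset.card_lt_card ⟨?_, ?_⟩
          · intro a ha
            simp only [proj, Finsupp.support_filter, Finset.mem_filter] at ha
            exact ha.1
          · intro hsub
            refine hi i fun a ha => ?_
            have := hsub ha
            simp only [proj, Finsupp.support_filter, Finset.mem_filter] at this
            exact this.2
      · exact le_max_of_le_left (tsirelsonNorm_nonneg x)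
    rcases le_max_iff.1 key with h | h
    · exact h
    · have h1 := (hθ 1 le_rfl).2
      have h2 := h0 x
      have h3 := tsirelsonNorm_nonneg (𝓑 := 𝓑) (θ := θ) (𝓕 := 𝓕) x
      nlinarith
  · refine ciSup_le fun j => ?_
    induction j generalizing x with
    | zero => rw [heq x]; exact le_max_left _ _
    | succ j ih =>
      rw [Function.iterate_succ_apply', heq x]
      exact step_mono hθ hb h0 ih x

end ImplicitEquation

end MixedTsirelson

/-! Write y for the endpoint sum ∑ aₖ e_{iₖ}. The engine is `block_estimate`: with N = m₀ and for
every depth d, the norm of ∑ aₖ uₖ is at most (1 + d/θ_N) ‖y‖ + ρ₂(y) + max(ε, θ₁^d) ∑ |aₖ|. The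
proof is by induction on d through the implicit equation. Depth 0 is the triangle inequality. At
depth d + 1 the 𝓕₀ term is controlled by ‖y‖ because spreading moves a set that meets blocks to
their endpoints. For a term θₙ ∑ ‖Eⱼ x‖ there are two regimes.

If n ≥ N, the inclusion of 𝓕ₙ in a bracket starting with 𝓖 collects the Eⱼ into 𝓖-admissible groups
(`Admissible.exists_grouping`). Blocks split by the groups have their endpoints in 𝓖 and are paid
for by ρ₂(y); any other block costs at most ε |aₖ| (`admissible_sum_le_of_large`).

If n < N, blocks meeting two of the Eⱼ have endpoints in 𝓕ₙ (`image_endpoints_mem`) and cost at most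
‖y‖/θ_N in total. Each remaining block meets at most one Eⱼ, so the induction hypothesis applies
inside each Eⱼ separately. `mul_sum_endpointSum_le` reassembles the endpoint norms without loss,
while the ℓ¹ coefficient is multiplied by θₙ ≤ θ₁. Taking d with θ₁^d < ε leaves the coefficient ε.
-/

namespace MixedTsirelson

/-! ### Projections and the lattice-norm properties of the mixed Tsirelson norm. -/

section Norm

variable {𝓑 : Set (Finset ℕ)} {θ : ℕ → ℝ} {𝓕 : ℕ → Set (Finset ℕ)}

theorem proj_apply (E : Finset ℕ) (x : ℕ →₀ ℝ) (n : ℕ) :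
    proj E x n = if n ∈ E then x n else 0 := by
  rw [proj, Finsupp.filter_apply]

theorem proj_add (E : Finset ℕ) (x y : ℕ →₀ ℝ) : proj E (x + y) = proj E x + proj E y := by
  ext n; simp only [proj_apply, Finsupp.add_apply]; split_ifs <;> simp

theorem proj_smul (E : Finset ℕ) (c : ℝ) (x : ℕ →₀ ℝ) : proj E (c • x) = c • proj E x := by
  ext n; simp only [proj_apply, Finsupp.smul_apply]; split_ifs <;> simp

theorem proj_zero (E : Finset ℕ) : proj E 0 = 0 := by
  ext n; simp [proj_apply]

theorem proj_sum {ι : Type*} (E : Finset ℕ) (S : Finset ι) (f : ι → ℕ →₀ ℝ) :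
    proj E (∑ k ∈ S, f k) = ∑ k ∈ S, proj E (f k) := by
  classical
  induction S using Finset.induction_on with
  | empty => simp [proj_zero]
  | insert a S ha ih => rw [Finset.sum_insert ha, Finset.sum_insert ha, proj_add, ih]

theorem proj_eq_zero {E : Finset ℕ} {x : ℕ →₀ ℝ} (h : ∀ n ∈ x.support, n ∉ E) :
    proj E x = 0 := by
  ext n
  rw [proj_apply]
  split_ifs with hn
  · by_contra h0
    exact h n (Finsupp.mem_support_iff.2 h0) hn
  · rfl

theorem support_proj_subset (E : Finset ℕ) (x : ℕ →₀ ℝ) : (proj E x).support ⊆ x.support := by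
  intro n hn
  rw [Finsupp.mem_support_iff, proj_apply] at hn
  rw [Finsupp.mem_support_iff]
  intro h
  simp [h] at hn

theorem abs_proj_le (E : Finset ℕ) (x : ℕ →₀ ℝ) (n : ℕ) : |proj E x n| ≤ |x n| := by
  rw [proj_apply]; split_ifs <;> simp

theorem sum_le_familyNorm {F : Finset ℕ} (hF : F ∈ 𝓑) (x : ℕ →₀ ℝ) :
    ∑ k ∈ F, |x k| ≤ familyNorm 𝓑 x :=
  le_csSup (familyNorm_bdd 𝓑 x) ⟨F, hF, rfl⟩

theorem familyNorm_mono {x y : ℕ →₀ ℝ} (h : ∀ n, |x n| ≤ |y n|) :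
    familyNorm 𝓑 x ≤ familyNorm 𝓑 y := by
  refine Real.sSup_le ?_ (familyNorm_nonneg 𝓑 y)
  rintro _ ⟨F, hF, rfl⟩
  exact (Finset.sum_le_sum fun n _ => h n).trans (sum_le_familyNorm hF y)

theorem familyNorm_add (x y : ℕ →₀ ℝ) :
    familyNorm 𝓑 (x + y) ≤ familyNorm 𝓑 x + familyNorm 𝓑 y := by
  refine Real.sSup_le ?_ (add_nonneg (familyNorm_nonneg 𝓑 x) (familyNorm_nonneg 𝓑 y))
  rintro _ ⟨F, hF, rfl⟩
  refine le_trans ?_ (add_le_add (sum_le_familyNorm hF x) (sum_le_familyNorm hF y))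
  rw [← Finset.sum_add_distrib]
  exact Finset.sum_le_sum fun n _ => abs_add_le _ _

theorem familyNorm_smul_le (c : ℝ) (x : ℕ →₀ ℝ) :
    familyNorm 𝓑 (c • x) ≤ |c| * familyNorm 𝓑 x := by
  refine Real.sSup_le ?_ (mul_nonneg (abs_nonneg c) (familyNorm_nonneg 𝓑 x))
  rintro _ ⟨F, hF, rfl⟩
  refine le_trans (le_of_eq ?_)
    (mul_le_mul_of_nonneg_left (sum_le_familyNorm hF x) (abs_nonneg c))
  rw [Finset.mul_sum]
  exact Finset.sum_congr rfl fun n _ => by rw [Finsupp.smul_apply, smul_eq_mul, abs_mul]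

theorem sSup_admissibleSums_nonneg (hθ : ∀ n, 1 ≤ n → 0 < θ n ∧ θ n < 1) {ν : (ℕ →₀ ℝ) → ℝ}
    (h0 : ∀ x, 0 ≤ ν x) (x : ℕ →₀ ℝ) : 0 ≤ sSup (admissibleSums θ 𝓕 ν x) := by
  refine Real.sSup_nonneg ?_
  rintro _ ⟨n, hn, k, E, hE, rfl⟩
  exact mul_nonneg (hθ n hn).1.le (Finset.sum_nonneg fun i _ => h0 _)

/-- To bound the norm, it suffices to bound both terms of the implicit equation. -/
theorem tsirelsonNorm_le_of (hθ : ∀ n, 1 ≤ n → 0 < θ n ∧ θ n < 1) {x : ℕ →₀ ℝ} {r : ℝ}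
    (h1 : familyNorm 𝓑 x ≤ r)
    (h2 : ∀ n, 1 ≤ n → ∀ (k : ℕ) (E : Fin k → Finset ℕ), Admissible (𝓕 n) E →
      θ n * ∑ i, tsirelsonNorm 𝓑 θ 𝓕 (proj (E i) x) ≤ r) :
    tsirelsonNorm 𝓑 θ 𝓕 x ≤ r := by
  rw [tsirelsonNorm_eq hθ]
  refine max_le h1 (Real.sSup_le ?_ ((familyNorm_nonneg 𝓑 x).trans h1))
  rintro _ ⟨n, hn, k, E, hE, rfl⟩
  exact h2 n hn k E hE

theorem familyNorm_le_tsirelsonNorm (hθ : ∀ n, 1 ≤ n → 0 < θ n ∧ θ n < 1) (x : ℕ →₀ ℝ) :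
    familyNorm 𝓑 x ≤ tsirelsonNorm 𝓑 θ 𝓕 x := by
  rw [tsirelsonNorm_eq hθ]; exact le_max_left _ _

theorem admissible_sum_le (hθ : ∀ n, 1 ≤ n → 0 < θ n ∧ θ n < 1) {n : ℕ} (hn : 1 ≤ n) {k : ℕ}
    {E : Fin k → Finset ℕ} (hE : Admissible (𝓕 n) E) (x : ℕ →₀ ℝ) :
    θ n * ∑ i, tsirelsonNorm 𝓑 θ 𝓕 (proj (E i) x) ≤ tsirelsonNorm 𝓑 θ 𝓕 x := by
  rw [tsirelsonNorm_eq hθ x]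
  exact le_max_of_le_right (le_csSup (admissibleSums_bdd hθ x) ⟨n, hn, k, E, hE, rfl⟩)

/-- The implicit equation has the norm on both sides, so monotonicity, subadditivity and homogeneity
are each proved by induction along the iterates of `step` and then passed to the supremum. -/
theorem iterate_mono_abs (hθ : ∀ n, 1 ≤ n → 0 < θ n ∧ θ n < 1) (j : ℕ) :
    ∀ x y : ℕ →₀ ℝ, (∀ n, |x n| ≤ |y n|) →
      (step 𝓑 θ 𝓕)^[j] (familyNorm 𝓑) x ≤ (step 𝓑 θ 𝓕)^[j] (familyNorm 𝓑) y := by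
  induction j with
  | zero => exact fun x y h => familyNorm_mono h
  | succ j ih =>
    intro x y h
    rw [Function.iterate_succ_apply']
    refine max_le_max (familyNorm_mono h)
      (Real.sSup_le ?_ (sSup_admissibleSums_nonneg hθ (iterate_nonneg j) y))
    rintro _ ⟨n, hn, k, E, hE, rfl⟩
    refine (mul_le_mul_of_nonneg_left (Finset.sum_le_sum fun i _ => ih _ (proj (E i) y) ?_)
      (hθ n hn).1.le).trans
      (le_csSup ⟨l1 y, admissibleSums_le hθ (iterate_le hθ j) y⟩ ⟨n, hn, k, E, hE, rfl⟩)
    intro m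
    rw [proj_apply, proj_apply]
    split_ifs
    · exact h m
    · exact le_rfl

theorem iterate_add (hθ : ∀ n, 1 ≤ n → 0 < θ n ∧ θ n < 1) (j : ℕ) :
    ∀ x y : ℕ →₀ ℝ, (step 𝓑 θ 𝓕)^[j] (familyNorm 𝓑) (x + y) ≤
      (step 𝓑 θ 𝓕)^[j] (familyNorm 𝓑) x + (step 𝓑 θ 𝓕)^[j] (familyNorm 𝓑) y := by
  induction j with
  | zero => exact familyNorm_add
  | succ j ih =>
    intro x y
    rw [Function.iterate_succ_apply']
    refine max_le ((familyNorm_add x y).trans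
      (add_le_add (le_max_left _ _) (le_max_left _ _))) ?_
    refine le_trans (Real.sSup_le ?_ (add_nonneg
      (sSup_admissibleSums_nonneg hθ (iterate_nonneg j) x)
      (sSup_admissibleSums_nonneg hθ (iterate_nonneg j) y)))
      (add_le_add (le_max_right _ _) (le_max_right _ _))
    rintro _ ⟨n, hn, k, E, hE, rfl⟩
    refine le_trans ?_ (add_le_add
      (le_csSup ⟨l1 x, admissibleSums_le hθ (iterate_le hθ j) x⟩ ⟨n, hn, k, E, hE, rfl⟩)
      (le_csSup ⟨l1 y, admissibleSums_le hθ (iterate_le hθ j) y⟩ ⟨n, hn, k, E, hE, rfl⟩))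
    rw [← mul_add, ← Finset.sum_add_distrib]
    refine mul_le_mul_of_nonneg_left (Finset.sum_le_sum fun i _ => ?_) (hθ n hn).1.le
    rw [proj_add]
    exact ih _ _

theorem iterate_smul_le (hθ : ∀ n, 1 ≤ n → 0 < θ n ∧ θ n < 1) (c : ℝ) (j : ℕ) :
    ∀ x : ℕ →₀ ℝ, (step 𝓑 θ 𝓕)^[j] (familyNorm 𝓑) (c • x) ≤
      |c| * (step 𝓑 θ 𝓕)^[j] (familyNorm 𝓑) x := by
  induction j with
  | zero => exact familyNorm_smul_le c
  | succ j ih =>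
    intro x
    rw [Function.iterate_succ_apply']
    refine max_le ((familyNorm_smul_le c x).trans
      (mul_le_mul_of_nonneg_left (le_max_left _ _) (abs_nonneg c))) ?_
    refine le_trans (Real.sSup_le ?_ (mul_nonneg (abs_nonneg c)
      (sSup_admissibleSums_nonneg hθ (iterate_nonneg j) x)))
      (mul_le_mul_of_nonneg_left (le_max_right _ _) (abs_nonneg c))
    rintro _ ⟨n, hn, k, E, hE, rfl⟩
    refine le_trans ?_ (mul_le_mul_of_nonneg_left
      (le_csSup ⟨l1 x, admissibleSums_le hθ (iterate_le hθ j) x⟩ ⟨n, hn, k, E, hE, rfl⟩)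
      (abs_nonneg c))
    rw [mul_left_comm, Finset.mul_sum (a := |c|)]
    refine mul_le_mul_of_nonneg_left (Finset.sum_le_sum fun i _ => ?_) (hθ n hn).1.le
    rw [proj_smul]
    exact ih _

theorem tsirelsonNorm_mono (hθ : ∀ n, 1 ≤ n → 0 < θ n ∧ θ n < 1) {x y : ℕ →₀ ℝ}
    (h : ∀ n, |x n| ≤ |y n|) : tsirelsonNorm 𝓑 θ 𝓕 x ≤ tsirelsonNorm 𝓑 θ 𝓕 y :=
  ciSup_mono (iterate_bdd hθ y) fun j => iterate_mono_abs hθ j x y h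

theorem tsirelsonNorm_proj_le (hθ : ∀ n, 1 ≤ n → 0 < θ n ∧ θ n < 1) (E : Finset ℕ)
    (x : ℕ →₀ ℝ) : tsirelsonNorm 𝓑 θ 𝓕 (proj E x) ≤ tsirelsonNorm 𝓑 θ 𝓕 x :=
  tsirelsonNorm_mono hθ (abs_proj_le E x)

theorem tsirelsonNorm_add (hθ : ∀ n, 1 ≤ n → 0 < θ n ∧ θ n < 1) (x y : ℕ →₀ ℝ) :
    tsirelsonNorm 𝓑 θ 𝓕 (x + y) ≤ tsirelsonNorm 𝓑 θ 𝓕 x + tsirelsonNorm 𝓑 θ 𝓕 y :=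
  ciSup_le fun j => (iterate_add hθ j x y).trans
    (add_le_add (le_ciSup (iterate_bdd hθ x) j) (le_ciSup (iterate_bdd hθ y) j))

theorem tsirelsonNorm_smul_le (hθ : ∀ n, 1 ≤ n → 0 < θ n ∧ θ n < 1) (c : ℝ) (x : ℕ →₀ ℝ) :
    tsirelsonNorm 𝓑 θ 𝓕 (c • x) ≤ |c| * tsirelsonNorm 𝓑 θ 𝓕 x :=
  ciSup_le fun j => (iterate_smul_le hθ c j x).trans
    (mul_le_mul_of_nonneg_left (le_ciSup (iterate_bdd hθ x) j) (abs_nonneg c))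

theorem tsirelsonNorm_zero (hθ : ∀ n, 1 ≤ n → 0 < θ n ∧ θ n < 1) :
    tsirelsonNorm 𝓑 θ 𝓕 0 = 0 :=
  le_antisymm ((tsirelsonNorm_le hθ 0).trans (by simp [l1])) (tsirelsonNorm_nonneg 0)

theorem tsirelsonNorm_sum_le (hθ : ∀ n, 1 ≤ n → 0 < θ n ∧ θ n < 1) {ι : Type*} (S : Finset ι)
    (a : ι → ℝ) (u : ι → ℕ →₀ ℝ) :
    tsirelsonNorm 𝓑 θ 𝓕 (∑ k ∈ S, a k • u k) ≤
      ∑ k ∈ S, |a k| * tsirelsonNorm 𝓑 θ 𝓕 (u k) := by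
  classical
  induction S using Finset.induction_on with
  | empty => simp [tsirelsonNorm_zero hθ]
  | insert b S hb ih =>
    rw [Finset.sum_insert hb, Finset.sum_insert hb]
    exact (tsirelsonNorm_add hθ _ _).trans (add_le_add (tsirelsonNorm_smul_le hθ _ _) ih)

/-- The lower estimate for an admissible family indexed by any finite set of a linear order. -/
theorem sum_proj_le (hθ : ∀ n, 1 ≤ n → 0 < θ n ∧ θ n < 1) {n : ℕ} (hn : 1 ≤ n) {ι : Type*}
    [LinearOrder ι] (J : Finset ι) (E : ι → Finset ℕ) (m : ι → ℕ)
    (hlt : ∀ i ∈ J, ∀ j ∈ J, i < j → ∀ a ∈ E i, ∀ b ∈ E j, a < b)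
    (hm : ∀ i ∈ J, IsLeast (E i : Set ℕ) (m i)) (hJ : J.image m ∈ 𝓕 n) (x : ℕ →₀ ℝ) :
    θ n * ∑ i ∈ J, tsirelsonNorm 𝓑 θ 𝓕 (proj (E i) x) ≤ tsirelsonNorm 𝓑 θ 𝓕 x := by
  classical
  have himg : Finset.univ.image (J.orderEmbOfFin rfl) = J := by
    ext i
    rw [← Finset.mem_coe, Finset.coe_image, Finset.coe_univ, Set.image_univ,
      Finset.range_orderEmbOfFin, Finset.mem_coe]
  have hadm : Admissible (𝓕 n) fun q => E (J.orderEmbOfFin rfl q) := by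
    refine ⟨fun i j hij => hlt _ (J.orderEmbOfFin_mem rfl i) _ (J.orderEmbOfFin_mem rfl j)
      ((J.orderEmbOfFin rfl).lt_iff_lt.2 hij), fun q => m (J.orderEmbOfFin rfl q),
      fun q => hm _ (J.orderEmbOfFin_mem rfl q), ?_⟩
    have : (Finset.univ.image fun q => m (J.orderEmbOfFin rfl q)) =
        (Finset.univ.image (J.orderEmbOfFin rfl)).image m := by
      rw [Finset.image_image]; rfl
    rwa [this, himg]
  refine le_of_eq_of_le ?_ (admissible_sum_le hθ hn hadm x)
  congr 1
  conv_lhs => rw [← himg]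
  rw [Finset.sum_image fun i _ j _ h => (J.orderEmbOfFin rfl).injective h]

end Norm

/-! ### Spreading and the endpoints of blocks. -/

section Families

variable {𝓜 : Set (Finset ℕ)}

/-- Spreading for two increasing enumerations of the same index set: apply the definition to φ = g ∘
f⁻¹ on the image of f. -/
theorem Spreading.image_mem (h : Spreading 𝓜) {ι : Type*} [LinearOrder ι] {A : Finset ι}
    {f g : ι → ℕ} (hf : StrictMonoOn f A) (hg : StrictMonoOn g A) (hfg : ∀ k ∈ A, f k ≤ g k)
    (hA : A.image f ∈ 𝓜) : A.image g ∈ 𝓜 := by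
  classical
  rcases A.eq_empty_or_nonempty with rfl | ⟨k₀, hk₀⟩
  · simpa using hA
  have : Nonempty ι := ⟨k₀⟩
  have hinv : ∀ k ∈ A, Function.invFunOn f (A : Set ι) (f k) = k := fun k hk =>
    hf.injOn.leftInvOn_invFunOn hk
  have := h _ hA (fun n => g (Function.invFunOn f (A : Set ι) n)) ?_ ?_
  · rw [Finset.image_image] at this
    convert this using 1
    refine Finset.image_congr fun k hk => ?_
    simp only [Function.comp_apply]
    rw [hinv k hk]
  · intro a ha b hb hab
    simp only [Finset.coe_image, Set.mem_image, Finset.mem_coe] at ha hb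
    obtain ⟨k, hk, rfl⟩ := ha
    obtain ⟨l, hl, rfl⟩ := hb
    simp only [hinv k hk, hinv l hl]
    exact hg hk hl ((hf.lt_iff_lt hk hl).1 hab)
  · intro a ha
    obtain ⟨k, hk, rfl⟩ := Finset.mem_image.1 ha
    rw [hinv k hk]
    exact hfg k hk

/-- The indices `iₖ` lie to the right of `supp uₖ` and to the left of the later supports. -/
structure IsEndpoints {p : ℕ} (i : Fin p → ℕ) (u : Fin p → ℕ →₀ ℝ) : Prop where
  strictMono : StrictMono i
  le : ∀ k, ∀ b ∈ (u k).support, b ≤ i k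
  lt : ∀ k l, k < l → ∀ b ∈ (u l).support, i k < b

/-- Cutting a block may remove its last coordinate or the whole block. Since only inequalities are
required, the original endpoints survive; this is what lets the induction keep the vectors e_{iₖ}
fixed. -/
theorem IsEndpoints.proj {p : ℕ} {i : Fin p → ℕ} {u : Fin p → ℕ →₀ ℝ} (h : IsEndpoints i u)
    (E : Finset ℕ) : IsEndpoints i fun k => proj E (u k) where
  strictMono := h.strictMono
  le k b hb := h.le k b (support_proj_subset _ _ hb)
  lt k l hkl b hb := h.lt k l hkl b (support_proj_subset _ _ hb)

/-- `v` meets two of the sets `E₁, …, Eᵣ`. -/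
def IsSplit {r : ℕ} (E : Fin r → Finset ℕ) (v : ℕ →₀ ℝ) : Prop :=
  ∃ j j' : Fin r, j < j' ∧ (∃ b ∈ v.support, b ∈ E j) ∧ ∃ b ∈ v.support, b ∈ E j'

/-- The endpoints of the blocks that are split by an `𝓜`-admissible sequence belong to `𝓜`. -/
theorem image_endpoints_mem (hh : Hereditary 𝓜) (hs : Spreading 𝓜) {r : ℕ}
    {E : Fin r → Finset ℕ} (hE : Admissible 𝓜 E) {p : ℕ} {i : Fin p → ℕ}
    {u : Fin p → ℕ →₀ ℝ} (hu : IsEndpoints i u) (A : Finset (Fin p))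
    (hA : ∀ k ∈ A, IsSplit E (u k)) : A.image i ∈ 𝓜 := by
  classical
  obtain ⟨hlt, m, hm, hmem⟩ := hE
  rcases A.eq_empty_or_nonempty with rfl | ⟨k₀, hk₀⟩
  · exact hh _ hmem _ (by simp)
  have : Nonempty (Fin r) := ⟨(hA k₀ hk₀).choose⟩
  choose! j j' hjj' hj hj' using hA
  have hle : ∀ k ∈ A, m (j' k) ≤ i k := fun k hk => by
    obtain ⟨b, hb, hbE⟩ := hj' k hk
    exact ((hm _).2 hbE).trans (hu.le k b hb)
  -- Send k to the minimum of the later set that uₖ meets. For k < l, this minimum is at most iₖ,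
  -- which precedes a point of uₗ in the earlier set met by uₗ, hence precedes the minimum of its
  -- later set. Meeting two sets is what makes the map strictly increasing.
  refine hs.image_mem (f := fun k => m (j' k)) ?_ (hu.strictMono.strictMonoOn _) hle
    (hh _ hmem _ ?_)
  · intro k hk l hl hkl
    obtain ⟨b, hb, hbE⟩ := hj l hl
    exact (hle k hk).trans_lt ((hu.lt k l hkl b hb).trans
      (hlt _ _ (hjj' l hl) b hbE _ (hm _).1))
  · intro n hn
    obtain ⟨k, -, rfl⟩ := Finset.mem_image.1 hn
    exact Finset.mem_image_of_mem _ (Finset.mem_univ _)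

/-- One point of F chosen in each support gives a subset of F, and the endpoints are a spread of it.
-/
theorem image_endpoints_mem_of_meets (hh : Hereditary 𝓜) (hs : Spreading 𝓜) {F : Finset ℕ}
    (hF : F ∈ 𝓜) {p : ℕ} {i : Fin p → ℕ} {u : Fin p → ℕ →₀ ℝ} (hu : IsEndpoints i u)
    (A : Finset (Fin p)) (hA : ∀ k ∈ A, ∃ b ∈ (u k).support, b ∈ F) : A.image i ∈ 𝓜 := by
  classical
  choose! b hb hbF using hA
  refine hs.image_mem (f := b) ?_ (hu.strictMono.strictMonoOn _) (fun k hk => hu.le k _ (hb k hk))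
    (hh _ hF _ ?_)
  · intro k hk l hl hkl
    exact (hu.le k _ (hb k hk)).trans_lt (hu.lt k l hkl _ (hb l hl))
  · intro n hn
    obtain ⟨k, hk, rfl⟩ := Finset.mem_image.1 hn
    exact hbF k hk

end Families

/-! ### Lower estimates for iterated admissibility. -/

section Grouping

variable {𝓑 : Set (Finset ℕ)} {θ : ℕ → ℝ} {𝓕 : ℕ → Set (Finset ℕ)}

/-- A sequence admissible for `[𝓖, 𝓕ₙ₁, …, 𝓕ₙₛ]` can be grouped into a `𝓖`-admissible sequence
so that each group satisfies a lower estimate with constant `θₙ₁ ⋯ θₙₛ`. -/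
theorem Admissible.exists_grouping (hθ : ∀ n, 1 ≤ n → 0 < θ n ∧ θ n < 1) (𝓖 : Set (Finset ℕ))
    (ns : List ℕ) (hns : ∀ n ∈ ns, 1 ≤ n) :
    ∀ {k : ℕ} {E : Fin k → Finset ℕ}, Admissible (bracket 𝓖 (ns.map 𝓕)) E →
      ∃ (r : ℕ) (C : Fin r → Finset ℕ) (c : Fin k → Fin r), Admissible 𝓖 C ∧
        (∀ i, E i ⊆ C (c i)) ∧
        ∀ (v : ℕ →₀ ℝ) (j : Fin r),
          (ns.map θ).prod * ∑ i with c i = j, tsirelsonNorm 𝓑 θ 𝓕 (proj (E i) v) ≤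
            tsirelsonNorm 𝓑 θ 𝓕 (proj (C j) v) := by
  classical
  induction ns using List.reverseRecOn with
  | nil =>
    intro k E hE
    refine ⟨k, E, id, hE, fun i => subset_rfl, fun v j => ?_⟩
    simp [Finset.filter_eq']
  | append_singleton L n ih =>
    intro k E hE
    have hn : 1 ≤ n := hns n (by simp)
    have hL : ∀ n ∈ L, 1 ≤ n := fun n h => hns n (by simp [h])
    obtain ⟨hlt, m, hm, hmem⟩ := hE
    -- The bracket is a left fold, so its last family is the innermost: the set of minima is a union
    -- of sets M s in 𝓕ₙ whose own minima belong to the bracket of the shorter list.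
    rw [List.map_append, bracket, List.foldl_append] at hmem
    obtain ⟨k', M, hM, ⟨hMlt, μ, hμ, hμmem⟩, hunion⟩ := hmem
    have hmono : ∀ i i', m i < m i' → i < i' := by
      intro i i' h
      by_contra hle
      rcases (not_lt.1 hle).lt_or_eq with h' | h'
      · exact lt_asymm h (hlt _ _ h' _ (hm _).1 _ (hm _).1)
      · rw [h'] at h; exact lt_irrefl _ h
    have hinj : Function.Injective m := by
      intro i i' h
      rcases lt_trichotomy i i' with h' | h' | h'
      · exact absurd (hlt _ _ h' _ (hm _).1 _ (hm _).1) (by rw [h]; exact lt_irrefl _)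
      · exact h'
      · exact absurd (hlt _ _ h' _ (hm _).1 _ (hm _).1) (by rw [h]; exact lt_irrefl _)
    have hq : ∀ i, ∃ q, m i ∈ M q := fun i => by
      have : m i ∈ Finset.univ.biUnion M := by
        rw [← hunion]; exact Finset.mem_image_of_mem _ (Finset.mem_univ _)
      simpa using this
    choose q hq using hq
    have hqM : ∀ s, ∀ b ∈ M s, ∃ i, q i = s ∧ m i = b := by
      intro s b hb
      have : b ∈ Finset.univ.image m := by
        rw [hunion]; exact Finset.mem_biUnion.2 ⟨s, Finset.mem_univ _, hb⟩
      obtain ⟨i, -, rfl⟩ := Finset.mem_image.1 this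
      refine ⟨i, ?_, rfl⟩
      by_contra hne
      rcases lt_or_gt_of_ne hne with h | h
      · exact lt_irrefl _ (hMlt _ _ h _ (hq i) _ hb)
      · exact lt_irrefl _ (hMlt _ _ h _ hb _ (hq i))
    -- Merge the Eᵢ whose minima lie in the same M s. The merged set has minimum min M s, so the
    -- merged sequence is admissible for the shorter bracket, and each merge costs one factor θₙ.
    let E' : Fin k' → Finset ℕ := fun s => (Finset.univ.filter fun i => q i = s).biUnion E
    have hmemE' : ∀ s b, b ∈ E' s ↔ ∃ i, q i = s ∧ b ∈ E i := by
      intro s b; simp [E']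
    have hE' : Admissible (bracket 𝓖 (L.map 𝓕)) E' := by
      refine ⟨?_, μ, ?_, hμmem⟩
      · intro s s' hss a ha b hb
        obtain ⟨i, rfl, hi⟩ := (hmemE' _ _).1 ha
        obtain ⟨i', rfl, hi'⟩ := (hmemE' _ _).1 hb
        exact hlt _ _ (hmono _ _ (hMlt _ _ hss _ (hq i) _ (hq i'))) a hi b hi'
      · intro s
        refine ⟨?_, ?_⟩
        · obtain ⟨i, hi, hmi⟩ := hqM s _ (hμ s).1
          exact (hmemE' _ _).2 ⟨i, hi, hmi ▸ (hm i).1⟩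
        · intro b hb
          obtain ⟨i, rfl, hi⟩ := (hmemE' _ _).1 hb
          exact ((hμ _).2 (hq i)).trans ((hm i).2 hi)
    obtain ⟨r, C, c, hC, hsub, hest⟩ := ih hL hE'
    refine ⟨r, C, fun i => c (q i), hC, fun i b hb => hsub _ ((hmemE' _ _).2 ⟨i, rfl, hb⟩), ?_⟩
    intro v j
    have hgroup : ∀ s, θ n * ∑ i with q i = s, tsirelsonNorm 𝓑 θ 𝓕 (proj (E i) v) ≤
        tsirelsonNorm 𝓑 θ 𝓕 (proj (E' s) v) := by
      intro s
      have himg : (Finset.univ.filter fun i => q i = s).image m = M s := by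
        ext b
        simp only [Finset.mem_image, Finset.mem_filter, Finset.mem_univ, true_and]
        constructor
        · rintro ⟨i, rfl, rfl⟩; exact hq i
        · exact hqM s b
      refine le_of_eq_of_le ?_ (sum_proj_le hθ hn (Finset.univ.filter fun i => q i = s) E m
        (fun i _ i' _ h => hlt i i' h) (fun i _ => hm i) (himg ▸ hM s) (proj (E' s) v))
      congr 1
      refine Finset.sum_congr rfl fun i hi => ?_
      congr 1
      ext b
      simp only [proj_apply]
      by_cases hb : b ∈ E i
      · have : b ∈ E' s := (hmemE' _ _).2 ⟨i, (Finset.mem_filter.1 hi).2, hb⟩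
        simp [hb, this]
      · simp [hb]
    have hprod : 0 ≤ (L.map θ).prod := by
      refine List.prod_nonneg fun t ht => ?_
      obtain ⟨l, hl, rfl⟩ := List.mem_map.1 ht
      exact (hθ l (hL l hl)).1.le
    refine le_trans ?_ (hest v j)
    rw [List.map_append, List.prod_append, List.map_singleton, List.prod_singleton, mul_assoc]
    refine mul_le_mul_of_nonneg_left ?_ hprod
    refine le_trans (le_of_eq ?_) (Finset.sum_le_sum fun s _ => hgroup s)
    rw [← Finset.mul_sum]
    congr 1
    rw [← Finset.sum_fiberwise_of_maps_to (s := Finset.univ.filter fun i => c (q i) = j)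
      (t := Finset.univ.filter fun s => c s = j) (g := q) (by simp)]
    refine Finset.sum_congr rfl fun s hs => Finset.sum_congr ?_ fun _ _ => rfl
    ext i
    simp only [Finset.mem_filter, Finset.mem_univ, true_and] at hs ⊢
    constructor
    · exact fun h => h.2
    · rintro rfl; exact ⟨hs, rfl⟩

end Grouping

/-! ### Comparison of block sums with endpoint sums. -/

section Endpoints

variable {𝓑 : Set (Finset ℕ)} {θ : ℕ → ℝ} {𝓕 : ℕ → Set (Finset ℕ)} {p : ℕ} {i : Fin p → ℕ}

theorem endpointSum_apply (hi : Function.Injective i) (a : Fin p → ℝ) {S : Finset (Fin p)}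
    {l : Fin p} (hl : l ∈ S) : (∑ k ∈ S, a k • Finsupp.single (i k) (1 : ℝ)) (i l) = a l := by
  rw [Finsupp.finsetSum_apply, Finset.sum_eq_single l]
  · simp
  · intro k _ hk
    simp [hi.ne hk]
  · exact fun h => absurd hl h

theorem proj_endpointSum (hi : Function.Injective i) (a : Fin p → ℝ) {S T : Finset (Fin p)}
    (h : T ⊆ S) : proj (T.image i) (∑ k ∈ S, a k • Finsupp.single (i k) (1 : ℝ)) =
      ∑ k ∈ T, a k • Finsupp.single (i k) (1 : ℝ) := by
  classical
  rw [proj_sum, ← Finset.sum_subset h]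
  · refine Finset.sum_congr rfl fun k hk => ?_
    ext n
    rw [proj_apply]
    split_ifs with hn
    · rfl
    · have : i k ≠ n := fun h => hn (h ▸ Finset.mem_image_of_mem _ hk)
      simp [this]
  · intro k _ hkT
    ext n
    rw [proj_apply]
    split_ifs with hn
    · obtain ⟨l, hl, rfl⟩ := Finset.mem_image.1 hn
      have : k ≠ l := fun h => hkT (h ▸ hl)
      simp [hi.ne this]
    · rfl

theorem sum_abs_le_familyNorm (hi : Function.Injective i) (a : Fin p → ℝ)
    {S A : Finset (Fin p)} (h : A ⊆ S) (hA : A.image i ∈ 𝓑) :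
    ∑ k ∈ A, |a k| ≤ familyNorm 𝓑 (∑ k ∈ S, a k • Finsupp.single (i k) (1 : ℝ)) := by
  refine le_of_eq_of_le ?_ (sum_le_familyNorm hA _)
  rw [Finset.sum_image fun k _ l _ h => hi h]
  exact Finset.sum_congr rfl fun k hk => by rw [endpointSum_apply hi a (h hk)]

/-- The singletons {iₖ} form an admissible sequence, and each coordinate is seen by the 𝓑-norm. -/
theorem mul_sum_abs_le (hθ : ∀ n, 1 ≤ n → 0 < θ n ∧ θ n < 1) (hsing : ∀ k, {k} ∈ 𝓑)
    (hi : StrictMono i) (a : Fin p → ℝ) {S A : Finset (Fin p)} (h : A ⊆ S) {n : ℕ} (hn : 1 ≤ n)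
    (hA : A.image i ∈ 𝓕 n) :
    θ n * ∑ k ∈ A, |a k| ≤
      tsirelsonNorm 𝓑 θ 𝓕 (∑ k ∈ S, a k • Finsupp.single (i k) (1 : ℝ)) := by
  refine le_trans (mul_le_mul_of_nonneg_left (Finset.sum_le_sum fun k hk => ?_) (hθ n hn).1.le)
    (sum_proj_le hθ hn A (fun k => {i k}) i ?_ ?_ hA _)
  · refine le_trans ?_ (familyNorm_le_tsirelsonNorm hθ _)
    refine le_of_eq_of_le ?_ (sum_le_familyNorm (hsing (i k)) _)
    rw [Finset.sum_singleton, proj_apply, if_pos (Finset.mem_singleton_self _),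
      endpointSum_apply hi.injective a (h hk)]
  · intro k _ l _ hkl b hb c hc
    rw [Finset.mem_singleton.1 hb, Finset.mem_singleton.1 hc]
    exact hi hkl
  · intro k _
    simp

/-- The blocks met by a set of 𝓑 have their endpoints in 𝓑, and each contributes at most |aₖ|
because its own 𝓑-norm is at most 1. -/
theorem familyNorm_block_le (hh : Hereditary 𝓑) (hs : Spreading 𝓑) {u : Fin p → ℕ →₀ ℝ}
    (hu : IsEndpoints i u) (h1 : ∀ k, familyNorm 𝓑 (u k) ≤ 1) (a : Fin p → ℝ)
    (S : Finset (Fin p)) :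
    familyNorm 𝓑 (∑ k ∈ S, a k • u k) ≤
      familyNorm 𝓑 (∑ k ∈ S, a k • Finsupp.single (i k) (1 : ℝ)) := by
  classical
  refine Real.sSup_le ?_ (familyNorm_nonneg _ _)
  rintro _ ⟨F, hF, rfl⟩
  let A := S.filter fun k => ∃ b ∈ (u k).support, b ∈ F
  have hA : A.image i ∈ 𝓑 := image_endpoints_mem_of_meets hh hs hF hu A
    fun k hk => (Finset.mem_filter.1 hk).2
  refine le_trans ?_ (sum_abs_le_familyNorm hu.strictMono.injective a (Finset.filter_subset _ _) hA)
  calc ∑ n ∈ F, |(∑ k ∈ S, a k • u k) n|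
      ≤ ∑ n ∈ F, ∑ k ∈ S, |a k| * |u k n| := by
        refine Finset.sum_le_sum fun n _ => ?_
        rw [Finsupp.finsetSum_apply]
        refine (Finset.abs_sum_le_sum_abs _ _).trans (le_of_eq ?_)
        exact Finset.sum_congr rfl fun k _ => by rw [Finsupp.smul_apply, smul_eq_mul, abs_mul]
    _ = ∑ k ∈ S, |a k| * ∑ n ∈ F, |u k n| := by
        rw [Finset.sum_comm]
        exact Finset.sum_congr rfl fun k _ => by rw [Finset.mul_sum]
    _ = ∑ k ∈ A, |a k| * ∑ n ∈ F, |u k n| := by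
        refine (Finset.sum_subset (Finset.filter_subset _ _) fun k hk hkA => ?_).symm
        rw [Finset.sum_eq_zero, mul_zero]
        intro n hn
        by_contra h0
        refine hkA (Finset.mem_filter.2 ⟨hk, n, Finsupp.mem_support_iff.2 fun h => h0 ?_, hn⟩)
        rw [h, abs_zero]
    _ ≤ ∑ k ∈ A, |a k| := Finset.sum_le_sum fun k _ =>
        mul_le_of_le_one_right (abs_nonneg _) ((sum_le_familyNorm hF _).trans (h1 k))

theorem mul_sum_tsirelsonNorm_proj_le (hθ : ∀ n, 1 ≤ n → 0 < θ n ∧ θ n < 1) {n : ℕ} (hn : 1 ≤ n)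
    {r : ℕ} (E : Fin r → Finset ℕ) (u : Fin p → ℕ →₀ ℝ) (a : Fin p → ℝ) (S : Finset (Fin p)) :
    θ n * ∑ j, tsirelsonNorm 𝓑 θ 𝓕 (proj (E j) (∑ k ∈ S, a k • u k)) ≤
      ∑ k ∈ S, |a k| * (θ n * ∑ j, tsirelsonNorm 𝓑 θ 𝓕 (proj (E j) (u k))) := by
  have : ∑ k ∈ S, |a k| * (θ n * ∑ j, tsirelsonNorm 𝓑 θ 𝓕 (proj (E j) (u k))) =
      θ n * ∑ j, ∑ k ∈ S, |a k| * tsirelsonNorm 𝓑 θ 𝓕 (proj (E j) (u k)) := by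
    rw [Finset.sum_comm, Finset.mul_sum]
    refine Finset.sum_congr rfl fun k _ => ?_
    rw [← Finset.mul_sum]
    ring
  rw [this]
  refine mul_le_mul_of_nonneg_left (Finset.sum_le_sum fun j _ => ?_) (hθ n hn).1.le
  rw [proj_sum]
  simp only [proj_smul]
  exact tsirelsonNorm_sum_le hθ S a _

/-- The estimate for admissible sums with a large index: the blocks that are split by the groups
of `Admissible.exists_grouping` have their endpoints in `𝓖`, the others contribute little. -/
theorem admissible_sum_le_of_large (hθ : ∀ n, 1 ≤ n → 0 < θ n ∧ θ n < 1) {ε : ℝ} (hε : 0 < ε)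
    {𝓖 : Set (Finset ℕ)} (hG : IsRegular 𝓖) {ns : List ℕ} (hns : ∀ n ∈ ns, 1 ≤ n) {n : ℕ}
    (hn : 1 ≤ n) (hlt : θ n < ε * (ns.map θ).prod) (hsub : 𝓕 n ⊆ bracket 𝓖 (ns.map 𝓕))
    {r : ℕ} {E : Fin r → Finset ℕ} (hE : Admissible (𝓕 n) E) {u : Fin p → ℕ →₀ ℝ}
    (hu : IsEndpoints i u) (h1 : ∀ k, tsirelsonNorm 𝓑 θ 𝓕 (u k) ≤ 1) (a : Fin p → ℝ)
    (S : Finset (Fin p)) :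
    θ n * ∑ j, tsirelsonNorm 𝓑 θ 𝓕 (proj (E j) (∑ k ∈ S, a k • u k)) ≤
      familyNorm 𝓖 (∑ k ∈ S, a k • Finsupp.single (i k) (1 : ℝ)) + ε * ∑ k ∈ S, |a k| := by
  classical
  have hE' : Admissible (bracket 𝓖 (ns.map 𝓕)) E :=
    ⟨hE.1, hE.2.choose, hE.2.choose_spec.1, hsub hE.2.choose_spec.2⟩
  obtain ⟨t, C, c, hC, hEC, hest⟩ := hE'.exists_grouping (𝓑 := 𝓑) hθ 𝓖 ns hns
  let A := S.filter fun k => IsSplit C (u k)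
  have hA : A.image i ∈ 𝓖 := image_endpoints_mem hG.hereditary hG.spreading hC hu A
    fun k hk => (Finset.mem_filter.1 hk).2
  -- Such a block may still be split by E, but all its nonzero pieces lie in a single group. The
  -- lower estimate of that group bounds the product of the θ's times the sum of pieces by 1, and θₙ
  -- is less than ε times this product.
  have hsmall : ∀ k, ¬ IsSplit C (u k) →
      θ n * ∑ j, tsirelsonNorm 𝓑 θ 𝓕 (proj (E j) (u k)) ≤ ε := by
    intro k hk
    by_cases hz : ∀ j, tsirelsonNorm 𝓑 θ 𝓕 (proj (E j) (u k)) = 0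
    · simp [hz, hε.le]
    push Not at hz
    obtain ⟨j₀, hj₀⟩ := hz
    have hmeet : ∀ j, tsirelsonNorm 𝓑 θ 𝓕 (proj (E j) (u k)) ≠ 0 →
        ∃ b ∈ (u k).support, b ∈ C (c j) := by
      intro j hj
      by_contra hne
      push Not at hne
      refine hj ?_
      rw [proj_eq_zero fun b hb hbE => hne b hb (hEC j hbE), tsirelsonNorm_zero hθ]
    have hother : ∀ j, c j ≠ c j₀ → tsirelsonNorm 𝓑 θ 𝓕 (proj (E j) (u k)) = 0 := by
      intro j hj
      by_contra hne
      rcases lt_or_gt_of_ne hj with h | h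
      · exact hk ⟨_, _, h, hmeet j hne, hmeet j₀ hj₀⟩
      · exact hk ⟨_, _, h, hmeet j₀ hj₀, hmeet j hne⟩
    have hsum : ∑ j, tsirelsonNorm 𝓑 θ 𝓕 (proj (E j) (u k)) =
        ∑ j with c j = c j₀, tsirelsonNorm 𝓑 θ 𝓕 (proj (E j) (u k)) := by
      refine (Finset.sum_subset (Finset.filter_subset _ _) fun j _ hj => hother j ?_).symm
      simpa using hj
    have h2 := (hest (u k) (c j₀)).trans ((tsirelsonNorm_proj_le hθ _ _).trans (h1 k))
    rw [← hsum] at h2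
    have h3 : 0 ≤ ∑ j, tsirelsonNorm 𝓑 θ 𝓕 (proj (E j) (u k)) :=
      Finset.sum_nonneg fun j _ => tsirelsonNorm_nonneg _
    calc _ ≤ ε * (ns.map θ).prod * ∑ j, tsirelsonNorm 𝓑 θ 𝓕 (proj (E j) (u k)) :=
          mul_le_mul_of_nonneg_right hlt.le h3
      _ = ε * ((ns.map θ).prod * ∑ j, tsirelsonNorm 𝓑 θ 𝓕 (proj (E j) (u k))) := mul_assoc _ _ _
      _ ≤ ε := mul_le_of_le_one_right hε.le h2
  refine (mul_sum_tsirelsonNorm_proj_le hθ hn E u a S).trans ?_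
  rw [← Finset.sum_filter_add_sum_filter_not S (fun k => IsSplit C (u k))]
  refine add_le_add ((Finset.sum_le_sum fun k _ => ?_).trans
    (sum_abs_le_familyNorm hu.strictMono.injective a (Finset.filter_subset _ _) hA)) ?_
  · exact mul_le_of_le_one_right (abs_nonneg _) ((admissible_sum_le hθ hn hE _).trans (h1 k))
  · rw [Finset.mul_sum]
    refine (Finset.sum_le_sum fun k hk => ?_).trans (Finset.sum_le_sum_of_subset_of_nonneg
      (Finset.filter_subset _ _) fun k _ _ => mul_nonneg hε.le (abs_nonneg (a k)))
    rw [mul_comm]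
    exact mul_le_mul_of_nonneg_right (hsmall k (Finset.mem_filter.1 hk).2) (abs_nonneg _)

/-- The endpoints of the blocks that meet only one set of an admissible sequence inherit the lower
estimate of that sequence. -/
theorem mul_sum_endpointSum_le (hθ : ∀ n, 1 ≤ n → 0 < θ n ∧ θ n < 1) {n : ℕ} (hn : 1 ≤ n)
    (hh : Hereditary (𝓕 n)) (hs : Spreading (𝓕 n)) {r : ℕ} {E : Fin r → Finset ℕ}
    (hE : Admissible (𝓕 n) E) {u : Fin p → ℕ →₀ ℝ} (hu : IsEndpoints i u) (a : Fin p → ℝ)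
    {S : Finset (Fin p)} {T : Fin r → Finset (Fin p)} (hTS : ∀ j, T j ⊆ S)
    (hT : ∀ j, ∀ k ∈ T j, ∃ b ∈ (u k).support, b ∈ E j)
    (hdisj : ∀ j j' k, k ∈ T j → k ∈ T j' → j = j') :
    θ n * ∑ j, tsirelsonNorm 𝓑 θ 𝓕 (∑ k ∈ T j, a k • Finsupp.single (i k) (1 : ℝ)) ≤
      tsirelsonNorm 𝓑 θ 𝓕 (∑ k ∈ S, a k • Finsupp.single (i k) (1 : ℝ)) := by
  classical
  have hi := hu.strictMono
  obtain ⟨hlt, m, hm, hmem⟩ := hE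
  let J : Finset (Fin r) := Finset.univ.filter fun j => (T j).Nonempty
  have hleast : ∀ j ∈ J, ∃ e, ∃ k ∈ T j, e = i k ∧ ∀ k' ∈ T j, k ≤ k' := fun j hj =>
    have h := (Finset.mem_filter.1 hj).2
    ⟨_, (T j).min' h, Finset.min'_mem _ _, rfl, fun k hk => Finset.min'_le _ _ hk⟩
  choose! e he using hleast
  -- Disjointness of the T j excludes k = k'; k' < k would place a point of E j' before a point of E
  -- j.
  have horder : ∀ j j', j < j' → ∀ k ∈ T j, ∀ k' ∈ T j', k < k' := by
    intro j j' hjj k hk k' hk'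
    obtain ⟨b, hb, hbE⟩ := hT j k hk
    obtain ⟨b', hb', hbE'⟩ := hT j' k' hk'
    have hbb := hlt j j' hjj b hbE b' hbE'
    rcases lt_trichotomy k k' with h | h | h
    · exact h
    · subst h
      exact absurd (hdisj _ _ _ hk hk') hjj.ne
    · exact absurd ((hu.le _ _ hb').trans_lt (hu.lt _ _ h b hb)) hbb.not_gt
  have hmlt : ∀ j j', j < j' → m j < m j' := fun j j' h =>
    hlt j j' h _ (hm j).1 _ (hm j').1
  -- An endpoint iₖ may fall outside E j, so the E j are replaced by the endpoint sets of the
  -- nonempty T j. Their minima e j dominate m j, so spreading keeps them admissible.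
  have key := sum_proj_le (𝓑 := 𝓑) (𝓕 := 𝓕) hθ hn J (fun j => (T j).image i) e ?_ ?_ ?_
    (∑ k ∈ S, a k • Finsupp.single (i k) (1 : ℝ))
  · refine le_of_eq_of_le ?_ key
    congr 1
    simp only [proj_endpointSum hi.injective a (hTS _)]
    refine (Finset.sum_subset (Finset.subset_univ _) fun j _ hj => ?_).symm
    have : T j = ∅ := by simpa [J, Finset.not_nonempty_iff_eq_empty] using hj
    rw [this, Finset.sum_empty, tsirelsonNorm_zero hθ]
  · intro j _ j' _ hjj b hb b' hb'
    obtain ⟨k, hk, rfl⟩ := Finset.mem_image.1 hb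
    obtain ⟨k', hk', rfl⟩ := Finset.mem_image.1 hb'
    exact hi (horder j j' hjj k hk k' hk')
  · intro j hj
    obtain ⟨k, hk, hek, hmin⟩ := he j hj
    rw [hek]
    refine ⟨Finset.mem_coe.2 (Finset.mem_image_of_mem _ hk), ?_⟩
    intro b hb
    obtain ⟨k', hk', rfl⟩ := Finset.mem_image.1 (Finset.mem_coe.1 hb)
    exact hi.monotone (hmin k' hk')
  · refine hs.image_mem (f := m) (fun j _ j' _ h => hmlt j j' h) ?_ ?_
      (hh _ hmem _ (Finset.image_subset_image (Finset.subset_univ _)))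
    · intro j hj j' hj' h
      obtain ⟨k, hk, hek, -⟩ := he j hj
      obtain ⟨k', hk', hek', -⟩ := he j' hj'
      rw [hek, hek']
      exact hi (horder j j' h k hk k' hk')
    · intro j hj
      obtain ⟨k, hk, hek, -⟩ := he j hj
      obtain ⟨b, hb, hbE⟩ := hT j k hk
      rw [hek]
      exact ((hm j).2 hbE).trans (hu.le _ b hb)

/-- The estimate for an admissible sum in terms of the split blocks and of the sums over the
blocks that meet only one set. -/
theorem exists_decomposition (hθ : ∀ n, 1 ≤ n → 0 < θ n ∧ θ n < 1) {n : ℕ} (hn : 1 ≤ n)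
    {r : ℕ} {E : Fin r → Finset ℕ} (hE : Admissible (𝓕 n) E) {u : Fin p → ℕ →₀ ℝ}
    (h1 : ∀ k, tsirelsonNorm 𝓑 θ 𝓕 (u k) ≤ 1) (a : Fin p → ℝ) (S : Finset (Fin p)) :
    ∃ (A : Finset (Fin p)) (T : Fin r → Finset (Fin p)), A ⊆ S ∧ (∀ k ∈ A, IsSplit E (u k)) ∧
      (∀ j, T j ⊆ S) ∧ (∀ j, ∀ k ∈ T j, ∃ b ∈ (u k).support, b ∈ E j) ∧
      (∀ j j' k, k ∈ T j → k ∈ T j' → j = j') ∧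
      θ n * ∑ j, tsirelsonNorm 𝓑 θ 𝓕 (proj (E j) (∑ k ∈ S, a k • u k)) ≤
        ∑ k ∈ A, |a k| +
          θ n * ∑ j, tsirelsonNorm 𝓑 θ 𝓕 (∑ k ∈ T j, a k • proj (E j) (u k)) := by
  classical
  let A := S.filter fun k => IsSplit E (u k)
  let T : Fin r → Finset (Fin p) := fun j =>
    S.filter fun k => ¬ IsSplit E (u k) ∧ ∃ b ∈ (u k).support, b ∈ E j
  refine ⟨A, T, Finset.filter_subset _ _, fun k hk => (Finset.mem_filter.1 hk).2,
    fun j => Finset.filter_subset _ _, fun j k hk => (Finset.mem_filter.1 hk).2.2, ?_, ?_⟩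
  · intro j j' k hk hk'
    have h := (Finset.mem_filter.1 hk).2
    have h' := (Finset.mem_filter.1 hk').2
    rcases lt_trichotomy j j' with hj | hj | hj
    · exact absurd ⟨j, j', hj, h.2, h'.2⟩ h.1
    · exact hj
    · exact absurd ⟨j', j, hj, h'.2, h.2⟩ h.1
  have hsplit : ∀ j, proj (E j) (∑ k ∈ S, a k • u k) =
      proj (E j) (∑ k ∈ A, a k • u k) + ∑ k ∈ T j, a k • proj (E j) (u k) := by
    intro j
    rw [← Finset.sum_filter_add_sum_filter_not S (fun k => IsSplit E (u k)), proj_add]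
    congr 1
    rw [proj_sum]
    simp only [proj_smul]
    refine (Finset.sum_subset ?_ fun k hk hkT => ?_).symm
    · intro k hk
      have := Finset.mem_filter.1 hk
      exact Finset.mem_filter.2 ⟨this.1, this.2.1⟩
    · have hk := Finset.mem_filter.1 hk
      rw [proj_eq_zero, smul_zero]
      intro b hb hbE
      exact hkT (Finset.mem_filter.2 ⟨hk.1, hk.2, b, hb, hbE⟩)
  -- For a single block the implicit equation gives θₙ ∑ⱼ ‖Eⱼ uₖ‖ ≤ ‖uₖ‖ ≤ 1.
  have hA : θ n * ∑ j, tsirelsonNorm 𝓑 θ 𝓕 (proj (E j) (∑ k ∈ A, a k • u k)) ≤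
      ∑ k ∈ A, |a k| :=
    (mul_sum_tsirelsonNorm_proj_le hθ hn E u a A).trans (Finset.sum_le_sum fun k _ =>
      mul_le_of_le_one_right (abs_nonneg _) ((admissible_sum_le hθ hn hE _).trans (h1 k)))
  refine le_trans ?_ (add_le_add_left hA _)
  rw [← mul_add, ← Finset.sum_add_distrib]
  refine mul_le_mul_of_nonneg_left (Finset.sum_le_sum fun j _ => ?_) (hθ n hn).1.le
  rw [hsplit]
  exact tsirelsonNorm_add hθ _ _

/-- The induction on d replaces the blocks by their restrictions to Eⱼ and S by a subset, so u and S
are quantified inside and the blocks need only have norm at most 1; a and i stay fixed. -/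
theorem block_estimate (h𝓕 : ∀ n, IsRegular (𝓕 n)) (hsing : ∀ k, {k} ∈ 𝓕 0)
    (hθ : ∀ n, 1 ≤ n → 0 < θ n ∧ θ n < 1) (hθ_anti : ∀ m n, 1 ≤ m → m ≤ n → θ n ≤ θ m)
    {ε : ℝ} (hε : 0 < ε) {N : ℕ} (hN : 1 ≤ N) {𝓖 : Set (Finset ℕ)} (hG : IsRegular 𝓖)
    (hlarge : ∀ m, N ≤ m → ∃ ns : List ℕ, (∀ n ∈ ns, 1 ≤ n) ∧
      θ m < ε * (ns.map θ).prod ∧ 𝓕 m ⊆ bracket 𝓖 (ns.map 𝓕))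
    (a : Fin p → ℝ) (d : ℕ) :
    ∀ u : Fin p → ℕ →₀ ℝ, IsEndpoints i u → (∀ k, tsirelsonNorm (𝓕 0) θ 𝓕 (u k) ≤ 1) →
      ∀ S : Finset (Fin p), tsirelsonNorm (𝓕 0) θ 𝓕 (∑ k ∈ S, a k • u k) ≤
        (1 + d / θ N) * tsirelsonNorm (𝓕 0) θ 𝓕 (∑ k ∈ S, a k • Finsupp.single (i k) (1 : ℝ)) +
        tsirelsonNorm 𝓖 θ 𝓕 (∑ k ∈ S, a k • Finsupp.single (i k) (1 : ℝ)) +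
        max ε (θ 1 ^ d) * ∑ k ∈ S, |a k| := by
  have hN0 := (hθ N hN).1
  induction d with
  | zero =>
    intro u _ h1 S
    have h2 : tsirelsonNorm (𝓕 0) θ 𝓕 (∑ k ∈ S, a k • u k) ≤ ∑ k ∈ S, |a k| :=
      (tsirelsonNorm_sum_le hθ S a u).trans (Finset.sum_le_sum fun k _ =>
        mul_le_of_le_one_right (abs_nonneg _) (h1 k))
    have h3 : ∑ k ∈ S, |a k| ≤ max ε (θ 1 ^ 0) * ∑ k ∈ S, |a k| :=
      le_mul_of_one_le_left (Finset.sum_nonneg fun k _ => abs_nonneg _)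
        (by rw [pow_zero]; exact le_max_right _ _)
    have h4 := tsirelsonNorm_nonneg (𝓑 := 𝓕 0) (θ := θ) (𝓕 := 𝓕)
      (∑ k ∈ S, a k • Finsupp.single (i k) (1 : ℝ))
    have h5 := tsirelsonNorm_nonneg (𝓑 := 𝓖) (θ := θ) (𝓕 := 𝓕)
      (∑ k ∈ S, a k • Finsupp.single (i k) (1 : ℝ))
    simp only [Nat.cast_zero, zero_div, add_zero, one_mul]
    linarith
  | succ d ih =>
    intro u hu h1 S
    have hy := tsirelsonNorm_nonneg (𝓑 := 𝓕 0) (θ := θ) (𝓕 := 𝓕)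
      (∑ k ∈ S, a k • Finsupp.single (i k) (1 : ℝ))
    have hρ := tsirelsonNorm_nonneg (𝓑 := 𝓖) (θ := θ) (𝓕 := 𝓕)
      (∑ k ∈ S, a k • Finsupp.single (i k) (1 : ℝ))
    have hS : 0 ≤ ∑ k ∈ S, |a k| := Finset.sum_nonneg fun k _ => abs_nonneg _
    have hmax : 0 ≤ max ε (θ 1 ^ (d + 1)) := hε.le.trans (le_max_left _ _)
    have hd : 0 ≤ (d : ℝ) / θ N := by positivity
    have hd' : 0 ≤ ((d + 1 : ℕ) : ℝ) / θ N := by positivity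
    refine tsirelsonNorm_le_of hθ ?_ ?_
    · have h2 := familyNorm_block_le (h𝓕 0).hereditary (h𝓕 0).spreading hu
        (fun k => (familyNorm_le_tsirelsonNorm hθ _).trans (h1 k)) a S
      have h3 := familyNorm_le_tsirelsonNorm (𝓑 := 𝓕 0) (𝓕 := 𝓕) hθ
        (∑ k ∈ S, a k • Finsupp.single (i k) (1 : ℝ))
      nlinarith [mul_nonneg hd' hy, mul_nonneg hmax hS]
    · intro n hn r E hE
      rcases le_or_gt N n with hNn | hnN
      · obtain ⟨ns, hns, hlt, hsub⟩ := hlarge n hNn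
        have h2 := admissible_sum_le_of_large hθ hε hG hns hn hlt hsub hE hu h1 a S
        have h3 := familyNorm_le_tsirelsonNorm (𝓑 := 𝓖) (𝓕 := 𝓕) hθ
          (∑ k ∈ S, a k • Finsupp.single (i k) (1 : ℝ))
        have h4 := mul_le_mul_of_nonneg_right (le_max_left ε (θ 1 ^ (d + 1))) hS
        nlinarith [mul_nonneg hd' hy]
      · obtain ⟨A, T, hAS, hA, hTS, hT, hdisj, hle⟩ := exists_decomposition hθ hn hE h1 a S
        have hθn := (hθ n hn).1
        have hAn := mul_sum_abs_le hθ hsing hu.strictMono a hAS hn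
          (image_endpoints_mem (h𝓕 n).hereditary (h𝓕 n).spreading hE hu A hA)
        have hA0 : 0 ≤ ∑ k ∈ A, |a k| := Finset.sum_nonneg fun k _ => abs_nonneg _
        -- Since n < N, θₙ ≥ θ_N. This is the only loss in the first coefficient at each depth,
        -- whence d/θ_N.
        have hA1 : ∑ k ∈ A, |a k| ≤
            tsirelsonNorm (𝓕 0) θ 𝓕 (∑ k ∈ S, a k • Finsupp.single (i k) (1 : ℝ)) / θ N := by
          rw [le_div_iff₀ hN0, mul_comm]
          exact (mul_le_mul_of_nonneg_right (hθ_anti n N hn hnN.le) hA0).trans hAn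
        have hT0 := mul_sum_endpointSum_le (𝓑 := 𝓕 0) hθ hn (h𝓕 n).hereditary (h𝓕 n).spreading
          hE hu a hTS hT hdisj
        have hTG := mul_sum_endpointSum_le (𝓑 := 𝓖) hθ hn (h𝓕 n).hereditary (h𝓕 n).spreading
          hE hu a hTS hT hdisj
        have hTa : ∑ j, ∑ k ∈ T j, |a k| ≤ ∑ k ∈ S, |a k| := by
          classical
          rw [← Finset.sum_biUnion]
          · exact Finset.sum_le_sum_of_subset_of_nonneg
              (Finset.biUnion_subset.2 fun j _ => hTS j) fun k _ _ => abs_nonneg _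
          · intro j _ j' _ hjj
            exact Finset.disjoint_left.2 fun k hk hk' => hjj (hdisj j j' k hk hk')
        -- The ℓ¹ coefficient decays geometrically down to the floor ε, which the large indices
        -- impose.
        have hc : θ n * max ε (θ 1 ^ d) ≤ max ε (θ 1 ^ (d + 1)) := by
          rw [mul_max_of_nonneg _ _ hθn.le]
          refine max_le_max (mul_le_of_le_one_left hε.le (hθ n hn).2.le) ?_
          rw [pow_succ']
          exact mul_le_mul_of_nonneg_right (hθ_anti 1 n le_rfl hn) (pow_nonneg (hθ 1 le_rfl).1.le _)
        have hTa0 : 0 ≤ ∑ j, ∑ k ∈ T j, |a k| :=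
          Finset.sum_nonneg fun j _ => Finset.sum_nonneg fun k _ => abs_nonneg _
        have hstep : θ n * ∑ j, tsirelsonNorm (𝓕 0) θ 𝓕 (∑ k ∈ T j, a k • proj (E j) (u k)) ≤
            (1 + d / θ N) * (θ n * ∑ j, tsirelsonNorm (𝓕 0) θ 𝓕
              (∑ k ∈ T j, a k • Finsupp.single (i k) (1 : ℝ))) +
            θ n * ∑ j, tsirelsonNorm 𝓖 θ 𝓕 (∑ k ∈ T j, a k • Finsupp.single (i k) (1 : ℝ)) +
            θ n * max ε (θ 1 ^ d) * ∑ j, ∑ k ∈ T j, |a k| := by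
          refine (mul_le_mul_of_nonneg_left (Finset.sum_le_sum fun j _ =>
            ih (fun k => proj (E j) (u k)) (hu.proj _)
              (fun k => (tsirelsonNorm_proj_le hθ _ _).trans (h1 k)) (T j)) hθn.le).trans
            (le_of_eq ?_)
          rw [Finset.sum_add_distrib, Finset.sum_add_distrib, ← Finset.mul_sum, ← Finset.mul_sum]
          ring
        have e1 := mul_le_mul_of_nonneg_left hT0 (by linarith : 0 ≤ 1 + (d : ℝ) / θ N)
        have e2 := mul_le_mul hc hTa hTa0 hmax
        have e3 : (1 + ((d + 1 : ℕ) : ℝ) / θ N) * tsirelsonNorm (𝓕 0) θ 𝓕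
              (∑ k ∈ S, a k • Finsupp.single (i k) (1 : ℝ)) =
            (1 + d / θ N) * tsirelsonNorm (𝓕 0) θ 𝓕
              (∑ k ∈ S, a k • Finsupp.single (i k) (1 : ℝ)) +
            tsirelsonNorm (𝓕 0) θ 𝓕 (∑ k ∈ S, a k • Finsupp.single (i k) (1 : ℝ)) / θ N := by
          push_cast; ring
        rw [e3]
        linarith

end Endpoints

end MixedTsirelson

open MixedTsirelson in
theorem mainTheorem6
    (𝓕 : ℕ → Set (Finset ℕ)) (θ : ℕ → ℝ)
    (h𝓕 : ∀ n, IsRegular (𝓕 n))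
    (h𝓕_singleton : ∀ n k, {k} ∈ 𝓕 n)
    (h𝓕_union : IsRegular (⋃ n, 𝓕 n))
    (hθ : ∀ n, 1 ≤ n → 0 < θ n ∧ θ n < 1)
    (hθ_anti : ∀ m n, 1 ≤ m → m ≤ n → θ n ≤ θ m)
    (hθ_lim : Tendsto θ atTop (𝓝 0))
    (ε : ℝ) (hε : 0 < ε) (m₀ : ℕ) (hm₀ : 1 ≤ m₀) :
    ∃ K : ℝ, ∀ 𝓖 : Set (Finset ℕ), IsRegular 𝓖 →
      (∀ m, m₀ ≤ m → ∃ ns : List ℕ, ns ≠ [] ∧ (∀ n ∈ ns, 1 ≤ n) ∧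
        θ m < ε * (ns.map θ).prod ∧ 𝓕 m ⊆ bracket 𝓖 (ns.map 𝓕)) →
      ∀ (p : ℕ) (x : Fin p → ℕ →₀ ℝ), IsBlockSequence x →
        (∀ k, tsirelsonNorm (𝓕 0) θ 𝓕 (x k) = 1) →
        ∀ i : Fin p → ℕ, (∀ k, IsGreatest ((x k).support : Set ℕ) (i k)) →
        ∀ a : Fin p → ℝ,
          tsirelsonNorm (𝓕 0) θ 𝓕 (∑ k, a k • x k) ≤
            K * tsirelsonNorm (𝓕 0) θ 𝓕 (∑ k, a k • Finsupp.single (i k) 1) +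
            2 * ε * tsirelsonNorm (⋃ n, 𝓕 n) θ 𝓕 (∑ k, a k • Finsupp.single (i k) 1) +
            2 * tsirelsonNorm 𝓖 θ 𝓕 (∑ k, a k • Finsupp.single (i k) 1) +
            2 * ε * ∑ k, |a k| := by
  -- The depth is fixed before 𝓖 and the blocks, so the constant depends only on θ, ε and m₀.
  obtain ⟨d, hd⟩ := exists_pow_lt_of_lt_one hε (hθ 1 le_rfl).2
  refine ⟨1 + d / θ m₀, ?_⟩
  intro 𝓖 hG hlarge p x hx hnorm i hi a
  have hu : IsEndpoints i x :=
    { strictMono := fun k l hkl => hx.2 k l hkl _ (hi k).1 _ (hi l).1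
      le := fun k b hb => (hi k).2 hb
      lt := fun k l hkl b hb => hx.2 k l hkl _ (hi k).1 b hb }
  have key := block_estimate h𝓕 (h𝓕_singleton 0) hθ hθ_anti hε hm₀ hG
    (fun m hm => by
      obtain ⟨ns, -, hns, h⟩ := hlarge m hm
      exact ⟨ns, hns, h⟩) a d x hu (fun k => (hnorm k).le) Finset.univ
  -- The bound now reads K‖y‖ + ρ₂(y) + ε ∑ |aₖ|; the stated one follows by adding nonnegative
  -- terms.
  rw [max_eq_left hd.le] at key
  have h1 := tsirelsonNorm_nonneg (𝓑 := ⋃ n, 𝓕 n) (θ := θ) (𝓕 := 𝓕)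
    (∑ k, a k • Finsupp.single (i k) (1 : ℝ))
  have h2 := tsirelsonNorm_nonneg (𝓑 := 𝓖) (θ := θ) (𝓕 := 𝓕)
    (∑ k, a k • Finsupp.single (i k) (1 : ℝ))
  have h3 : 0 ≤ ∑ k, |a k| := Finset.sum_nonneg fun k _ => abs_nonneg _
  nlinarith [mul_nonneg hε.le h1, mul_nonneg hε.le h3]
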